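/- Let $a,N$ be integers with $1\le a\le N$. Let $d,b_0,\dots,b_d\ge 0$ be integers and let $c_1,\dots,c_d$ be positive integers different from $2$, with $c_1\ge 3$ if $b_0=0$ and $d\ge 1$. If $d=b_0=0$, assume moreover $a\ne N$. For positive integers $s_1,\dots,s_u$ let $$t^{\star}_{N,a}(s_1,\dots,s_u)=\sum_{k_1\ge\cdots\ge k_u\ge 0}\ \prod_{i=1}^u\frac1{(Nk_i+a)^{s_i}},\qquad t^{\star}_{N,a}(\emptyset)=1 .$$ For nonzero integers $s_1,\dots,s_u$ ($u\ge1$) let $$\widetilde t_{N,a}(s_1,\dots,s_u)=\lim_{n\to\infty}\ \sum_{n>k_1>\cdots>k_u\ge 0}\ \prod_{i=1}^u\frac{\operatorname{sign}(s_i)^{k_i}}{(Nk_i+a)^{|s_i|}}\cdot\frac{(2a/N)_{k_u}}{k_u!},$$ where $(x)_k=x(x+1)\cdots(x+k-1)$, and for a number $r$ let $$\widetilde t^{\,r}_{N,a}(s_1,\dots,s_u)=\sum_{\circ}\ r^{\#\text{pluses}}\ \widetilde t_{N,a}(s_1\circ s_2\circ\cdots\circ s_u),$$ where each $\circ$ is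 independently a comma or a plus, and the plus of two signed indices is defined by $s+l=|s|+|l|$ if $sl>0$ and $s+l=-(|s|+|l|)$ if $sl<0$. Write $\{s\}^m$ for $s$ repeated $m$ times (the empty string if $m\le 0$), $\delta(1)=1$, $\delta(c)=0$ for $c\ge3$, $|\boldsymbol c|=c_1+\cdots+c_d$, $\delta(\boldsymbol c)=\delta(c_1)+\cdots+\delta(c_d)$, and let $B$ be the Beta function. Then the series $t^{\star}_{N,a}(\{2\}^{b_0},c_1,\{2\}^{b_1},\dots,c_d,\{2\}^{b_d})$ and all values $\widetilde t_{N,a}$ occurring below converge, and $$t^{\star}_{N,a}(\{2\}^{b_0},c_1,\{2\}^{b_1},\dots,c_d,\{2\}^{b_d})=\frac{N\cdot 2^{|\boldsymbol c|+1-2d+2\delta(\boldsymbol c)}}{B\left(\frac aN,\frac aN\right)}\ \widetilde t^{\,1/2}_{N,a}\bigl(e_0,\{1\}^{c_1-3},e_1,\{1\}^{c_2-3},e_2,\dots,\{1\}^{c_d-3},e_d\bigr),$$ where, for $d\ge1$, $$e_0=(-1)^{\delta(c_1)-1}\bigl(2b_0+2-\delta(c_1)\bigr),\qquad e_d=(-1)^{\delta(c_d)}\bigl(2b_d+2-\delta(c_d)\bigr),$$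 $$e_i=(-1)^{\delta(c_i)+\delta(c_{i+1})}\bigl(2b_i+3-\delta(c_i)-\delta(c_{i+1})\bigr)\quad(1\le i\le d-1),$$ and, for $d=0$, the index is the single entry $e_0=-(2b_0+1)$. -/

import Mathlib

/-- The truncated multiple `t`-star value of level `N`:
`∑ 1 / ((N k₁ + a)^{s₁} ⋯ (N k_u + a)^{s_u})` over all integers `n ≥ k₁ ≥ ⋯ ≥ k_u ≥ 0`,
written as an iterated sum. It is `1` for the empty index. -/
noncomputable def tStarTrunc (N a : ℕ) : List ℕ → ℕ → ℝ
  | [], _ => 1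
  | s :: l, n => ∑ k ∈ Finset.range (n + 1), 1 / ((N : ℝ) * k + a) ^ s * tStarTrunc N a l k

/-- The multiple `t`-star value `t*_{N,a}(s)` of level `N`, the sum of the series over all
`k₁ ≥ ⋯ ≥ k_u ≥ 0` (whose terms are positive). -/
noncomputable def tStar (N a : ℕ) (s : List ℕ) : ℝ :=
  Filter.limUnder Filter.atTop (fun n : ℕ => tStarTrunc N a s n)

/-- The truncated alternating multiple `t`-value with Pochhammer factor: the sum over all integers
`n > k₁ > ⋯ > k_u ≥ 0` of
`∏ᵢ sign(sᵢ)^{kᵢ} / (N kᵢ + a)^{|sᵢ|} * (2a/N)_{k_u} / k_u!`,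
written as an iterated sum. Only nonempty indices with nonzero entries are of interest. -/
noncomputable def tTildeTrunc (N a : ℕ) : List ℤ → ℕ → ℝ
  | [], _ => 1
  | [s], n => ∑ k ∈ Finset.range n,
      (s.sign : ℝ) ^ k / ((N : ℝ) * k + a) ^ s.natAbs *
        ((ascPochhammer ℝ k).eval (2 * (a : ℝ) / N) / (k.factorial : ℝ))
  | s :: t :: l, n => ∑ k ∈ Finset.range n,
      (s.sign : ℝ) ^ k / ((N : ℝ) * k + a) ^ s.natAbs * tTildeTrunc N a (t :: l) k

/-- The alternating multiple `t`-value of level `N` with factorial and Pochhammer symbol, as the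
limit of its truncations in the outermost (largest) summation variable. -/
noncomputable def tTilde (N a : ℕ) (s : List ℤ) : ℝ :=
  Filter.limUnder Filter.atTop (fun n : ℕ => tTildeTrunc N a s n)

/-- The operation `s + l` on signed indices: add absolute values, multiply signs. -/
def signedAdd (s l : ℤ) : ℤ := if 0 < s * l then |s| + |l| else -(|s| + |l|)

/-- All indices `s ∘ s₂ ∘ ⋯ ∘ s_u` for `l = [s₂, …, s_u]`, where each `∘` is either a comma or a
signed plus, each listed together with its number of pluses. -/
def mergingsAux : ℤ → List ℤ → List (ℕ × List ℤ)
  | s, [] => [(0, [s])]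
  | s, t :: l =>
      (mergingsAux t l).map (fun p => (p.1, s :: p.2)) ++
      (mergingsAux (signedAdd s t) l).map (fun p => (p.1 + 1, p.2))

/-- All indices `s₁ ∘ s₂ ∘ ⋯ ∘ s_u`, each with its number of pluses. -/
def mergings : List ℤ → List (ℕ × List ℤ)
  | [] => [(0, [])]
  | s :: l => mergingsAux s l

/-- The interpolated alternating multiple `t`-value of level `N`:
`∑ r^{number of pluses} * tTilde (s₁ ∘ s₂ ∘ ⋯ ∘ s_u)`. -/
noncomputable def tTildeInterp (N a : ℕ) (r : ℝ) (s : List ℤ) : ℝ :=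
  ((mergings s).map (fun p => r ^ p.1 * tTilde N a p.2)).sum

/-- `δ(1) = 1` and `δ(c) = 0` for `c ≥ 3`. -/
def deltaOne (c : ℕ) : ℕ := if c = 1 then 1 else 0

/-- The index `({2}^{b₀}, c₁, {2}^{b₁}, …, c_d, {2}^{b_d})`. The entries `c₁, …, c_d` and
`b₀, …, b_d` are read off sequences; other terms of the sequences play no role. -/
def starIndex (d : ℕ) (b c : ℕ → ℕ) : List ℕ :=
  List.replicate (b 0) 2 ++
    (List.range d).flatMap (fun i => c (i + 1) :: List.replicate (b (i + 1)) 2)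

/-- The signed entry carrying `bᵢ`, for `0 ≤ i ≤ d`. -/
def signedEntry (d : ℕ) (b c : ℕ → ℕ) (i : ℕ) : ℤ :=
  if d = 0 then -(2 * (b 0 : ℤ) + 1)
  else if i = 0 then
    (-1) ^ (deltaOne (c 1) + 1) * (2 * (b 0 : ℤ) + 2 - deltaOne (c 1))
  else if i < d then
    (-1) ^ (deltaOne (c i) + deltaOne (c (i + 1))) *
      (2 * (b i : ℤ) + 3 - deltaOne (c i) - deltaOne (c (i + 1)))
  else
    (-1) ^ deltaOne (c d) * (2 * (b d : ℤ) + 2 - deltaOne (c d))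

/-- The signed index `(e₀, {1}^{c₁-3}, e₁, {1}^{c₂-3}, …, {1}^{c_d-3}, e_d)`, where
`eᵢ = signedEntry d b c i` and `{1}^m` is empty for `m ≤ 0` (whence the truncated subtraction). -/
def signedIndex (d : ℕ) (b c : ℕ → ℕ) : List ℤ :=
  signedEntry d b c 0 ::
    (List.range d).flatMap
      (fun i => List.replicate (c (i + 1) - 3) (1 : ℤ) ++ [signedEntry d b c (i + 1)])

/-!
The proof starts from an exact identity for the truncated star sums and then passes to the limit.
Write `x = a / N`, `p k = N k + a` and let
`W n k = (x)_{n+1}² / ((n - k)! (2x)_{n+k+1})` be the kernel `starKernel`. For a function `f` put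
`(𝒲 f) n = ∑_{k ≤ n} W n k * f k`.

Writing the star sum as an iterated sum, prepending an entry `c` to the index means: divide the
sum truncated at `m` by `p m ^ c` and sum over `m ≤ n`. Through `𝒲` these operations become
operations on `f`. Let `D` be division by `p`, let `σ` be multiplication by `(-1)^k`, and let `I` be
the summation over `j ≤ k` in which the last term counts one half (`halfSum`). The two recurrences
of the kernel in `n` and in `k` give
* `∑_{m ≤ n} p m ^ (-2) (𝒲 f) m = (𝒲 D² f) n` (`sum_starTransform_two`),
* `(p n)⁻¹ (𝒲 f) n = (𝒲 (2 σ I σ D f)) n` (`one_div_node_mul_starTransform`),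

and, since `4 σ I σ I = 1`, also `∑_{m ≤ n} p m ^ (-1) (𝒲 f) m = (𝒲 (2 D I f)) n`
(`sum_starTransform_one`). Hence an entry `2` acts as `D²`, an entry `1` as `2 D I`, and an entry
`c ≥ 3` as `2^(c-2) σ D² I (D I)^(c-3) D σ`. The empty star sum `1` is the transform of
`2 N (-1)^k (2x)_k / (k! p k)` (`starTransform_base`, a partial fraction expansion). Composing these
operators produces exactly the signed index of the theorem, the factors `2^(c-2)` and `2` giving
the power of two: this is `tStarTrunc_starIndex`. The weight one half of `I` at coinciding variables
is the interpolation at `1/2` (`sum_mergingsAux_tTildeTrunc`).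

In the limit `n → ∞` the kernel tends to `1 / B(x, x)` for every `k` by Euler's limit formula for
the Gamma function. It is antitone in `k`, so that Abel summation allows taking the limit as soon as
the series on the right converges, absolutely or not (`tendsto_sum_antitone_kernel_mul`). This also
yields the convergence of the star sums. The series on the right converge because the factor
`(2x)_k / k!` is at most `k + 1`, so that all inner sums are `O(√n)`; when the last entry is `-1`
one uses that `(2x)_k / (k! p k)` decreases, and for the index `(-1)` alone, where `a < N`, that it
also tends to zero.
-/

/-! ### The kernel and the transform it defines -/

/-- The linear form `N k + a` whose powers occur in the denominators. -/
noncomputable def node (N a k : ℕ) : ℝ := (N : ℝ) * k + a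

/-- The kernel `(x)_{n+1}² / ((n - k)! (2x)_{n+k+1})` with `x = a / N`. The quotient
`n! / (n - k)!` is written as a product of real numbers, so that the kernel vanishes for `k > n`. -/
noncomputable def starKernel (N a n k : ℕ) : ℝ :=
  (∏ j ∈ Finset.range (n + 1), ((a : ℝ) / N + j)) ^ 2 /
    ((∏ j ∈ Finset.range (n + 1), (2 * (a : ℝ) / N + j)) * n.factorial) *
    ∏ j ∈ Finset.range k, ((n : ℝ) - j) / (2 * (a : ℝ) / N + n + j + 1)

/-- The transform `f ↦ ∑_{k ≤ n} starKernel n k * f k`. -/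
noncomputable def starTransform (N a : ℕ) (f : ℕ → ℝ) (n : ℕ) : ℝ :=
  ∑ k ∈ Finset.range (n + 1), starKernel N a n k * f k

/-- Summation over `j ≤ k` in which the last term `j = k` counts one half. -/
noncomputable def halfSum (f : ℕ → ℝ) (k : ℕ) : ℝ := ∑ j ∈ Finset.range k, f j + f k / 2

/-- The factor `(2a/N)_k / k!`. -/
noncomputable def pochRatio (N a k : ℕ) : ℝ :=
  (ascPochhammer ℝ k).eval (2 * (a : ℝ) / N) / (k.factorial : ℝ)

theorem node_pos {a : ℕ} (N : ℕ) (ha : 0 < a) (k : ℕ) : 0 < node N a k := by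
  unfold node; positivity

theorem pochRatio_zero (N a : ℕ) : pochRatio N a 0 = 1 := by simp [pochRatio]

theorem pochRatio_succ (N a k : ℕ) :
    pochRatio N a (k + 1) = pochRatio N a k * ((2 * (a : ℝ) / N + k) / (k + 1)) := by
  have : (k.factorial : ℝ) ≠ 0 := by positivity
  rw [pochRatio, pochRatio, ascPochhammer_succ_right, Nat.factorial_succ]
  simp only [Polynomial.eval_mul, Polynomial.eval_add, Polynomial.eval_X,
    Polynomial.eval_natCast]
  push_cast
  field_simp

theorem halfSum_zero (f : ℕ → ℝ) : halfSum f 0 = f 0 / 2 := by simp [halfSum]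

theorem halfSum_succ (f : ℕ → ℝ) (k : ℕ) :
    halfSum f (k + 1) = halfSum f k + (f k + f (k + 1)) / 2 := by
  rw [halfSum, halfSum, Finset.sum_range_succ]; ring

theorem halfSum_const_mul (c : ℝ) (f : ℕ → ℝ) (k : ℕ) :
    halfSum (fun j => c * f j) k = c * halfSum f k := by
  simp only [halfSum, ← Finset.mul_sum]; ring

theorem starTransform_const_mul (N a : ℕ) (c : ℝ) (f : ℕ → ℝ) (n : ℕ) :
    starTransform N a (fun k => c * f k) n = c * starTransform N a f n := by
  simp only [starTransform, Finset.mul_sum]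
  exact Finset.sum_congr rfl fun k _ => by ring

theorem starKernel_succ_right {N a : ℕ} (hN : 0 < N) (ha : 0 < a) (n k : ℕ) :
    starKernel N a n (k + 1) * (node N a n + node N a (k + 1)) =
      starKernel N a n k * (node N a n - node N a k) := by
  have hN' : (0 : ℝ) < N := by exact_mod_cast hN
  have ha' : (0 : ℝ) < a := by exact_mod_cast ha
  have h1 : (0 : ℝ) < 2 * (a : ℝ) / N + n + k + 1 := by positivity
  have e1 : node N a n + node N a (k + 1) = N * (2 * (a : ℝ) / N + n + k + 1) := by
    simp only [node]; push_cast; field_simp; ring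
  have e2 : node N a n - node N a k = N * ((n : ℝ) - k) := by
    simp only [node]; ring
  rw [e1, e2, starKernel, starKernel, Finset.prod_range_succ _ k]
  field_simp

theorem starKernel_eq_zero {N a n k : ℕ} (h : n < k) : starKernel N a n k = 0 := by
  rw [starKernel, Finset.prod_eq_zero (Finset.mem_range.2 h) (by simp), mul_zero]

theorem starKernel_succ_left {N a : ℕ} (hN : 0 < N) (ha : 0 < a) (n k : ℕ) :
    starKernel N a n k * node N a (n + 1) ^ 2 =
      starKernel N a (n + 1) k * (node N a (n + 1) ^ 2 - node N a k ^ 2) := by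
  have hN' : (0 : ℝ) < N := by exact_mod_cast hN
  have ha' : (0 : ℝ) < a := by exact_mod_cast ha
  induction k with
  | zero =>
    have h1 : (0 : ℝ) < 2 * (a : ℝ) / N + ((n + 1 : ℕ) : ℝ) := by positivity
    have h2 : (0 : ℝ) < ∏ j ∈ Finset.range (n + 1), (2 * (a : ℝ) / N + j) :=
      Finset.prod_pos fun j _ => by positivity
    have h3 : (0 : ℝ) < n.factorial := by positivity
    have e1 : node N a (n + 1) = N * ((a : ℝ) / N + ((n + 1 : ℕ) : ℝ)) := by
      simp only [node]; field_simp; ring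
    have e2 : node N a (n + 1) ^ 2 - node N a 0 ^ 2 =
        N ^ 2 * ((2 * (a : ℝ) / N + ((n + 1 : ℕ) : ℝ)) * (n + 1)) := by
      simp only [node]; push_cast; field_simp; ring
    rw [e2, e1, starKernel, starKernel, Finset.prod_range_succ _ (n + 1),
      Finset.prod_range_succ _ (n + 1), Nat.factorial_succ]
    generalize ∏ j ∈ Finset.range (n + 1), (2 * (a : ℝ) / N + j) = A at *
    generalize ∏ j ∈ Finset.range (n + 1), ((a : ℝ) / N + j) = A' at *
    simp only [Finset.range_zero, Finset.prod_empty]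
    generalize 2 * (a : ℝ) / N + ((n + 1 : ℕ) : ℝ) = B at *
    push_cast
    field_simp
  | succ k ih =>
    have p1 := node_pos N ha n
    have p2 := node_pos N ha (k + 1)
    have p3 := node_pos N ha (n + 1)
    have r1 := starKernel_succ_right hN ha n k
    have r2 := starKernel_succ_right hN ha (n + 1) k
    have e1 : node N a (n + 1) = node N a n + N := by simp only [node]; push_cast; ring
    have e2 : node N a (k + 1) = node N a k + N := by simp only [node]; push_cast; ring
    have hne : (node N a n + node N a (k + 1)) ≠ 0 := by positivity
    apply mul_right_cancel₀ hne
    calc _ = (starKernel N a n (k + 1) * (node N a n + node N a (k + 1))) *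
            node N a (n + 1) ^ 2 := by ring
      _ = (starKernel N a n k * node N a (n + 1) ^ 2) * (node N a n - node N a k) := by
        rw [r1]; ring
      _ = (starKernel N a (n + 1) k * (node N a (n + 1) - node N a k)) *
            (node N a (n + 1) + node N a k) * (node N a n - node N a k) := by rw [ih]; ring
      _ = _ := by rw [← r2, e1, e2]; ring

/-! ### How the transform intertwines the iterated sums -/

/-- The increment of a transform in its upper bound is the transform of the function multiplied by
`node ^ 2`, divided by the square of the new node. -/
theorem starTransform_succ_sub {N a : ℕ} (hN : 0 < N) (ha : 0 < a) (f : ℕ → ℝ) (n : ℕ) :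
    starTransform N a f (n + 1) - starTransform N a f n =
      1 / node N a (n + 1) ^ 2 * starTransform N a (fun k => node N a k ^ 2 * f k) (n + 1) := by
  have e : starTransform N a f n = ∑ k ∈ Finset.range (n + 1 + 1), starKernel N a n k * f k := by
    rw [Finset.sum_range_succ, starKernel_eq_zero (Nat.lt_succ_self n), zero_mul, add_zero,
      starTransform]
  rw [e, starTransform, starTransform, ← Finset.sum_sub_distrib, Finset.mul_sum]
  refine Finset.sum_congr rfl fun k _ => ?_
  have h := starKernel_succ_left hN ha n k
  have hp := node_pos N ha (n + 1)
  field_simp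
  linear_combination (-f k) * h

/-- Summation against `node ^ (-2)` corresponds to division by `node ^ 2`. -/
theorem sum_starTransform_two {N a : ℕ} (hN : 0 < N) (ha : 0 < a) (f : ℕ → ℝ) (n : ℕ) :
    ∑ m ∈ Finset.range (n + 1), 1 / node N a m ^ 2 * starTransform N a f m =
      starTransform N a (fun k => f k / node N a k ^ 2) n := by
  induction n with
  | zero => simp [starTransform]; ring
  | succ n ih =>
    have h := starTransform_succ_sub hN ha (fun k => f k / node N a k ^ 2) n
    have e : (fun k => node N a k ^ 2 * (f k / node N a k ^ 2)) = f := by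
      funext k
      have := node_pos N ha k
      field_simp
    rw [e] at h
    rw [Finset.sum_range_succ, ih, ← h]; ring

/-- Multiplication by the node of the upper bound, in terms of the transformed functions: the
relation between `u` and `h` says `h = (1 - S) / (1 + S) u` for the shift `S`. -/
theorem node_mul_starTransform {N a : ℕ} (hN : 0 < N) (ha : 0 < a) {u h : ℕ → ℝ}
    (h0 : h 0 = u 0) (hs : ∀ k, h k + h (k + 1) = u (k + 1) - u k) (n : ℕ) :
    node N a n * starTransform N a h n = starTransform N a (fun k => node N a k * u k) n := by
  -- Summation by parts gives the partial sums of the difference in closed form.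
  have key : ∀ K, ∑ k ∈ Finset.range K,
      starKernel N a n k * (node N a k * u k - node N a n * h k) =
      -1 / 2 * starKernel N a n K * (node N a n + node N a K) * (u K - h K) := by
    intro K
    induction K with
    | zero => simp [h0]
    | succ K ih =>
      rw [Finset.sum_range_succ, ih]
      have r := starKernel_succ_right hN ha n K
      have e : u (K + 1) - h (K + 1) = u K + h K := by linear_combination -hs K
      rw [e]
      linear_combination (1 / 2 * (u K + h K)) * r
  have := key (n + 1)
  rw [starKernel_eq_zero (Nat.lt_succ_self n)] at this
  rw [starTransform, starTransform, Finset.mul_sum, eq_comm, ← sub_eq_zero,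
    ← Finset.sum_sub_distrib]
  calc _ = ∑ k ∈ Finset.range (n + 1),
        starKernel N a n k * (node N a k * u k - node N a n * h k) :=
        Finset.sum_congr rfl fun k _ => by ring
    _ = 0 := by rw [this]; ring

/-- Summation against `node ^ (-1)` corresponds to a half-weighted summation followed by division
by the node. -/
theorem sum_starTransform_one {N a : ℕ} (hN : 0 < N) (ha : 0 < a) (f : ℕ → ℝ) (n : ℕ) :
    ∑ m ∈ Finset.range (n + 1), 1 / node N a m ^ 1 * starTransform N a f m =
      starTransform N a (fun k => 2 * (halfSum f k / node N a k)) n := by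
  have h := sum_starTransform_two hN ha (fun k => node N a k * (2 * halfSum f k)) n
  have e : (fun k => node N a k * (2 * halfSum f k) / node N a k ^ 2) =
      fun k => 2 * (halfSum f k / node N a k) := by
    funext k
    have := node_pos N ha k
    field_simp
  rw [e] at h
  rw [← h]
  refine Finset.sum_congr rfl fun m _ => ?_
  rw [← node_mul_starTransform hN ha (u := fun k => 2 * halfSum f k) (h := f)
    (by simp only [halfSum_zero]; ring) (fun k => by simp only [halfSum_succ]; ring)]
  have := node_pos N ha m
  field_simp

/-- Division by the node of the upper bound corresponds to division by the node followed by an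
alternating half-weighted summation. -/
theorem one_div_node_mul_starTransform {N a : ℕ} (hN : 0 < N) (ha : 0 < a) (f : ℕ → ℝ) (n : ℕ) :
    1 / node N a n * starTransform N a f n = starTransform N a
      (fun k => 2 * ((-1) ^ k * halfSum (fun j => (-1) ^ j * (f j / node N a j)) k)) n := by
  have h := node_mul_starTransform hN ha (u := fun k => f k / node N a k)
    (h := fun k => 2 * ((-1) ^ k * halfSum (fun j => (-1) ^ j * (f j / node N a j)) k))
    (by simp only [halfSum_zero]; ring)
    (fun k => by
      have hsq : ((-1 : ℝ) ^ k) * (-1) ^ k = 1 := by rw [← mul_pow]; simp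
      simp only [halfSum_succ, pow_succ]
      linear_combination (f (k + 1) / node N a (k + 1) - f k / node N a k) * hsq) n
  have e : (fun k => node N a k * (f k / node N a k)) = f := by
    funext k
    have := node_pos N ha k
    field_simp
  rw [e] at h
  rw [← h]
  have := node_pos N ha n
  field_simp

/-- The constant function `1` is a transform: this is the partial fraction expansion of
`∏_{j ≤ n} (1 - z² / (x + j)²)⁻¹` at `z = 0`. -/
theorem starTransform_base {N a : ℕ} (hN : 0 < N) (ha : 0 < a) (n : ℕ) :
    starTransform N a (fun k => 2 * N * ((-1) ^ k / node N a k * pochRatio N a k)) n = 1 := by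
  have hN' : (0 : ℝ) < N := by exact_mod_cast hN
  have ha' : (0 : ℝ) < a := by exact_mod_cast ha
  induction n with
  | zero =>
    simp [starTransform, starKernel, node, pochRatio_zero]
    field_simp
  | succ n ih =>
    refine Eq.trans (sub_eq_zero.1 ?_) ih
    rw [starTransform_succ_sub hN ha]
    -- The sum telescopes.
    have key : ∀ K, (2 * ((n : ℝ) + 1)) * ∑ k ∈ Finset.range K, starKernel N a (n + 1) k *
          (node N a k ^ 2 * (2 * N * ((-1) ^ k / node N a k * pochRatio N a k))) =
        -2 * N * (-1) ^ K * pochRatio N a K * K *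
          (starKernel N a (n + 1) K * (node N a (n + 1) + node N a K)) := by
      intro K
      induction K with
      | zero => simp
      | succ K ihK =>
        rw [Finset.sum_range_succ, mul_add, ihK]
        have r := starKernel_succ_right hN ha (n + 1) K
        have hp := node_pos N ha K
        have e : node N a K ^ 2 * (2 * N * ((-1) ^ K / node N a K * pochRatio N a K)) =
            2 * N * node N a K * (-1) ^ K * pochRatio N a K := by field_simp
        rw [e, r, pochRatio_succ]
        simp only [node]
        push_cast
        field_simp
        ring
    have := key (n + 1 + 1)
    rw [starKernel_eq_zero (Nat.lt_succ_self (n + 1)), zero_mul, mul_zero] at this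
    rw [starTransform, (mul_eq_zero.1 this).resolve_left (by positivity), mul_zero]

/-! ### Nested sums in which coinciding variables are weighted by one half -/

/-- The factor `sign(s)^k / (N k + a)^{|s|}` of a signed entry `s`. -/
noncomputable def signedFactor (N a : ℕ) (s : ℤ) (k : ℕ) : ℝ :=
  (s.sign : ℝ) ^ k / node N a k ^ s.natAbs

/-- The inner sum `∑_{k ≥ k₁ ≥ ⋯ ≥ k_u ≥ 0}` of the `1/2`-interpolated nested sum, every equality
sign between neighbouring variables being weighted by `1/2`; it is `(2a/N)_k / k!` for the empty
index. -/
noncomputable def interpSum (N a : ℕ) : List ℤ → ℕ → ℝ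
  | [], k => pochRatio N a k
  | s :: l, k => halfSum (fun j => signedFactor N a s j * interpSum N a l j) k

/-- The summand in the largest variable of the `1/2`-interpolated nested sum of index `s :: l`. -/
noncomputable def interpTerm (N a : ℕ) (s : ℤ) (l : List ℤ) (k : ℕ) : ℝ :=
  signedFactor N a s k * interpSum N a l k

theorem interpSum_cons (N a : ℕ) (s : ℤ) (l : List ℤ) :
    interpSum N a (s :: l) = halfSum (interpTerm N a s l) := rfl

/-- The entry obtained from `s` by adding `1` to its absolute value and flipping its sign. -/
def flipSucc (s : ℤ) : ℤ := -(s + s.sign)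

theorem signedFactor_flipSucc {N a : ℕ} {s : ℤ} (hs : s ≠ 0) (k : ℕ) :
    signedFactor N a (flipSucc s) k = (-1) ^ k * (signedFactor N a s k / node N a k) := by
  rcases lt_or_gt_of_ne hs with h | h
  · have h1 : (flipSucc s).sign = 1 := by
      rw [flipSucc, Int.sign_eq_neg_one_of_neg h]; exact Int.sign_eq_one_of_pos (by omega)
    have h2 : (flipSucc s).natAbs = s.natAbs + 1 := by
      rw [flipSucc, Int.sign_eq_neg_one_of_neg h]; omega
    have hsq : ((-1 : ℝ) ^ k) * (-1) ^ k = 1 := by rw [← mul_pow]; simp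
    rw [signedFactor, signedFactor, h1, h2, Int.sign_eq_neg_one_of_neg h, div_div, ← pow_succ,
      ← mul_div_assoc]
    push_cast
    rw [hsq, one_pow]
  · have h1 : (flipSucc s).sign = -1 := by
      rw [flipSucc, Int.sign_eq_one_of_pos h]; exact Int.sign_eq_neg_one_of_neg (by omega)
    have h2 : (flipSucc s).natAbs = s.natAbs + 1 := by
      rw [flipSucc, Int.sign_eq_one_of_pos h]; omega
    rw [signedFactor, signedFactor, h1, h2, Int.sign_eq_one_of_pos h, div_div, ← pow_succ,
      ← mul_div_assoc]
    push_cast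
    rw [one_pow, mul_one]

theorem tStarTrunc_cons (N a s : ℕ) (l : List ℕ) (n : ℕ) :
    tStarTrunc N a (s :: l) n =
      ∑ m ∈ Finset.range (n + 1), 1 / node N a m ^ s * tStarTrunc N a l m := rfl

/-- Prepending a block `{2}^m` multiplies the transformed function by `node ^ (-2 m)`. -/
theorem tStarTrunc_replicate_two_append {N a : ℕ} (hN : 0 < N) (ha : 0 < a) {l : List ℕ}
    {f : ℕ → ℝ} (h : ∀ n, tStarTrunc N a l n = starTransform N a f n) (m n : ℕ) :
    tStarTrunc N a (List.replicate m 2 ++ l) n =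
      starTransform N a (fun k => f k / node N a k ^ (2 * m)) n := by
  induction m generalizing n with
  | zero => simpa using h n
  | succ m ih =>
    rw [List.replicate_succ, List.cons_append, tStarTrunc_cons]
    simp only [ih]
    rw [sum_starTransform_two hN ha]
    congr 1
    funext k
    rw [div_div, ← pow_add]
    ring_nf

/-- Division by a power of the node of the upper bound introduces entries `1`. -/
theorem one_div_node_pow_mul_starTransform {N a : ℕ} (hN : 0 < N) (ha : 0 < a) {s : ℤ}
    (hs : s ≠ 0) (l : List ℤ) (m n : ℕ) :
    1 / node N a n ^ (m + 1) * starTransform N a (interpTerm N a s l) n =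
      starTransform N a (fun k => 2 ^ (m + 1) *
        ((-1) ^ k * interpSum N a (List.replicate m 1 ++ flipSucc s :: l) k)) n := by
  induction m with
  | zero =>
    rw [pow_one, one_div_node_mul_starTransform hN ha]
    congr 1
    funext k
    rw [zero_add, pow_one, List.replicate_zero, List.nil_append, interpSum_cons]
    congr 3
    funext j
    rw [interpTerm, interpTerm, signedFactor_flipSucc hs]
    ring
  | succ m ih =>
    rw [pow_succ', ← one_div_mul_one_div, mul_assoc, ih, one_div_node_mul_starTransform hN ha]
    congr 1
    funext k
    rw [List.replicate_succ, List.cons_append, interpSum_cons]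
    have e : (fun j => (-1 : ℝ) ^ j * (2 ^ (m + 1) * ((-1) ^ j *
        interpSum N a (List.replicate m 1 ++ flipSucc s :: l) j) / node N a j)) =
        fun j => 2 ^ (m + 1) * interpTerm N a 1 (List.replicate m 1 ++ flipSucc s :: l) j := by
      funext j
      have hsq : ((-1 : ℝ) ^ j) * (-1) ^ j = 1 := by rw [← mul_pow]; simp
      rw [interpTerm, signedFactor]
      simp only [Int.sign_one, Int.cast_one, one_pow, Int.natAbs_one, pow_one]
      linear_combination (2 ^ (m + 1) *
        interpSum N a (List.replicate m 1 ++ flipSucc s :: l) j / node N a j) * hsq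
    rw [e, halfSum_const_mul]
    ring

/-- Prepending an entry `c ≥ 3`. -/
theorem tStarTrunc_cons_of_three_le {N a : ℕ} (hN : 0 < N) (ha : 0 < a) {l : List ℕ} {s : ℤ}
    (hs : s ≠ 0) {t : List ℤ} {C : ℝ}
    (h : ∀ n, tStarTrunc N a l n = C * starTransform N a (interpTerm N a s t) n) {c : ℕ}
    (hc : 3 ≤ c) (n : ℕ) :
    tStarTrunc N a (c :: l) n = starTransform N a (fun k => C * 2 ^ (c - 2) *
      interpTerm N a (-2) (List.replicate (c - 3) 1 ++ flipSucc s :: t) k) n := by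
  obtain ⟨m, rfl⟩ := Nat.exists_eq_add_of_le' hc
  have e : m + 3 - 3 = m := by omega
  have e' : m + 3 - 2 = m + 1 := by omega
  rw [tStarTrunc_cons, e, e', starTransform_const_mul, mul_assoc, ← starTransform_const_mul]
  have e2 : (fun k => 2 ^ (m + 1) *
        interpTerm N a (-2) (List.replicate m 1 ++ flipSucc s :: t) k) =
      fun k => 2 ^ (m + 1) * ((-1) ^ k *
        interpSum N a (List.replicate m 1 ++ flipSucc s :: t) k) / node N a k ^ 2 := by
    funext k
    have h1 : (-2 : ℤ).sign = -1 := rfl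
    have h2 : (-2 : ℤ).natAbs = 2 := rfl
    rw [interpTerm, signedFactor, h1, h2]
    push_cast
    ring
  rw [e2, ← sum_starTransform_two hN ha, Finset.mul_sum]
  refine Finset.sum_congr rfl fun k _ => ?_
  rw [h, ← one_div_node_pow_mul_starTransform hN ha hs,
    show m + 3 = 2 + (m + 1) by omega, pow_add, ← one_div_mul_one_div]
  ring

/-- Prepending an entry `1`. -/
theorem tStarTrunc_cons_one {N a : ℕ} (hN : 0 < N) (ha : 0 < a) {l : List ℕ} {s : ℤ}
    {t : List ℤ} {C : ℝ}
    (h : ∀ n, tStarTrunc N a l n = C * starTransform N a (interpTerm N a s t) n) (n : ℕ) :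
    tStarTrunc N a (1 :: l) n =
      starTransform N a (fun k => C * 2 * interpTerm N a 1 (s :: t) k) n := by
  rw [tStarTrunc_cons, starTransform_const_mul, mul_assoc, ← starTransform_const_mul]
  have e2 : (fun k => 2 * interpTerm N a 1 (s :: t) k) =
      fun k => 2 * (halfSum (interpTerm N a s t) k / node N a k) := by
    funext k
    rw [interpTerm, signedFactor, interpSum_cons]
    simp only [Int.sign_one, Int.cast_one, one_pow, Int.natAbs_one, pow_one]
    ring
  rw [e2, ← sum_starTransform_one hN ha, Finset.mul_sum]
  exact Finset.sum_congr rfl fun k _ => by rw [h]; ring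

/-! ### The finite identity -/

theorem signedFactor_div_node_pow {N a : ℕ} {s r : ℤ} {m : ℕ} (h1 : r.sign = s.sign)
    (h2 : r.natAbs = s.natAbs + m) (k : ℕ) :
    signedFactor N a s k / node N a k ^ m = signedFactor N a r k := by
  rw [signedFactor, signedFactor, h1, h2, div_div, pow_add]

theorem deltaOne_one : deltaOne 1 = 1 := rfl

theorem deltaOne_of_three_le {c : ℕ} (hc : 3 ≤ c) : deltaOne c = 0 := by
  rw [deltaOne, if_neg (by omega)]

theorem eq_one_or_three_le {c : ℕ} (h : 1 ≤ c ∧ c ≠ 2) : c = 1 ∨ 3 ≤ c := by omega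

/-- The part of the signed index after its first entry; `signedIndex d b c` is by definition
`signedEntry d b c 0 :: signedTail d b c`. -/
def signedTail (d : ℕ) (b c : ℕ → ℕ) : List ℤ :=
  (List.range d).flatMap
    (fun i => List.replicate (c (i + 1) - 3) (1 : ℤ) ++ [signedEntry d b c (i + 1)])

theorem starIndex_succ (d : ℕ) (b c : ℕ → ℕ) :
    starIndex (d + 1) b c = List.replicate (b 0) 2 ++
      c 1 :: starIndex d (fun i => b (i + 1)) (fun i => c (i + 1)) := by
  rw [starIndex, List.range_succ_eq_map, List.flatMap_cons, List.flatMap_map, starIndex]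
  rfl

theorem signedEntry_succ_zero (d : ℕ) (b c : ℕ → ℕ) :
    signedEntry (d + 1) b c 0 =
      (-1) ^ (deltaOne (c 1) + 1) * (2 * (b 0 : ℤ) + 2 - deltaOne (c 1)) := by
  simp [signedEntry]

theorem signedEntry_succ_zero_of_eq_one {d : ℕ} {b c : ℕ → ℕ} (hc : c 1 = 1) :
    signedEntry (d + 1) b c 0 = 2 * (b 0 : ℤ) + 1 := by
  rw [signedEntry_succ_zero, hc, deltaOne_one]; push_cast; ring

theorem signedEntry_succ_zero_of_three_le {d : ℕ} {b c : ℕ → ℕ} (hc : 3 ≤ c 1) :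
    signedEntry (d + 1) b c 0 = -(2 * (b 0 : ℤ) + 2) := by
  rw [signedEntry_succ_zero, deltaOne_of_three_le hc]; push_cast; ring

theorem signedEntry_zero_ne_zero {d : ℕ} {b c : ℕ → ℕ}
    (hc : ∀ i, 1 ≤ i → i ≤ d → 1 ≤ c i ∧ c i ≠ 2) : signedEntry d b c 0 ≠ 0 := by
  cases d with
  | zero => simp only [signedEntry, if_true]; omega
  | succ d =>
    rcases eq_one_or_three_le (hc 1 le_rfl (by omega)) with h | h
    · rw [signedEntry_succ_zero_of_eq_one h]; omega
    · rw [signedEntry_succ_zero_of_three_le h]; omega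

theorem signedEntry_succ_add_two (d : ℕ) (b c : ℕ → ℕ) (i : ℕ) (hi : i < d) :
    signedEntry (d + 1) b c (i + 2) =
      signedEntry d (fun j => b (j + 1)) (fun j => c (j + 1)) (i + 1) := by
  have h1 : d ≠ 0 := by omega
  have h2 : (i + 2 < d + 1) ↔ (i + 1 < d) := by omega
  simp [signedEntry, h1, h2]

theorem signedEntry_succ_one_of_eq_one {d : ℕ} {b c : ℕ → ℕ} (hc : c 1 = 1) :
    signedEntry (d + 1) b c 1 =
      signedEntry d (fun j => b (j + 1)) (fun j => c (j + 1)) 0 := by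
  cases d with
  | zero => simp [signedEntry, hc, deltaOne_one]; ring
  | succ d => simp [signedEntry, hc, deltaOne_one]; ring

theorem signedEntry_succ_one_of_three_le {d : ℕ} {b c : ℕ → ℕ} (h1 : 3 ≤ c 1)
    (hc : ∀ i, 1 ≤ i → i ≤ d + 1 → 1 ≤ c i ∧ c i ≠ 2) :
    signedEntry (d + 1) b c 1 =
      flipSucc (signedEntry d (fun j => b (j + 1)) (fun j => c (j + 1)) 0) := by
  cases d with
  | zero =>
    have e : signedEntry 0 (fun j => b (j + 1)) (fun j => c (j + 1)) 0 = -(2 * (b 1 : ℤ) + 1) := by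
      simp [signedEntry]
    rw [e, flipSucc, Int.sign_eq_neg_one_of_neg (by omega)]
    simp [signedEntry, deltaOne_of_three_le h1]
    ring
  | succ d =>
    rcases eq_one_or_three_le (hc 2 (by omega) (by omega)) with h | h
    · rw [signedEntry_succ_zero_of_eq_one (c := fun j => c (j + 1)) h, flipSucc,
        Int.sign_eq_one_of_pos (by omega)]
      simp [signedEntry, deltaOne_of_three_le h1, h, deltaOne_one]
      ring
    · rw [signedEntry_succ_zero_of_three_le (c := fun j => c (j + 1)) h, flipSucc,
        Int.sign_eq_neg_one_of_neg (by omega)]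
      simp [signedEntry, deltaOne_of_three_le h1, deltaOne_of_three_le h]
      ring

theorem signedTail_succ (d : ℕ) (b c : ℕ → ℕ) :
    signedTail (d + 1) b c = List.replicate (c 1 - 3) 1 ++ signedEntry (d + 1) b c 1 ::
      signedTail d (fun j => b (j + 1)) (fun j => c (j + 1)) := by
  rw [signedTail, List.range_succ_eq_map, List.flatMap_cons, List.flatMap_map, List.append_assoc,
    List.singleton_append, signedTail]
  congr 2
  refine List.flatMap_congr fun i hi => ?_
  rw [← signedEntry_succ_add_two d b c i (List.mem_range.1 hi)]

/-- The exponent of `2` in the identity. -/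
def twoExponent (d : ℕ) (c : ℕ → ℕ) : ℤ :=
  (∑ i ∈ Finset.Icc 1 d, (c i : ℤ)) + 1 - 2 * (d : ℤ) +
    2 * ∑ i ∈ Finset.Icc 1 d, (deltaOne (c i) : ℤ)

theorem sum_Icc_one_succ (d : ℕ) (f : ℕ → ℤ) :
    ∑ i ∈ Finset.Icc 1 (d + 1), f i = f 1 + ∑ i ∈ Finset.Icc 1 d, f (i + 1) := by
  induction d with
  | zero => simp
  | succ d ih =>
    rw [Finset.sum_Icc_succ_top (by omega), ih, Finset.sum_Icc_succ_top (by omega), add_assoc]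

theorem twoExponent_succ (d : ℕ) (c : ℕ → ℕ) :
    twoExponent (d + 1) c = twoExponent d (fun i => c (i + 1)) + (c 1 - 2 + 2 * deltaOne (c 1)) := by
  rw [twoExponent, twoExponent, sum_Icc_one_succ d fun i => (c i : ℤ),
    sum_Icc_one_succ d fun i => (deltaOne (c i) : ℤ)]
  push_cast
  ring

/-- The truncated star sum as a transform of the summand of the `1/2`-interpolated nested sum. -/
theorem tStarTrunc_starIndex {N a : ℕ} (hN : 0 < N) (ha : 0 < a) (d : ℕ) (b c : ℕ → ℕ)
    (hc : ∀ i, 1 ≤ i → i ≤ d → 1 ≤ c i ∧ c i ≠ 2) (n : ℕ) :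
    tStarTrunc N a (starIndex d b c) n = N * 2 ^ twoExponent d c *
      starTransform N a (interpTerm N a (signedEntry d b c 0) (signedTail d b c)) n := by
  rw [← starTransform_const_mul]
  induction d generalizing b c n with
  | zero =>
    have e : starIndex 0 b c = List.replicate (b 0) 2 ++ [] := rfl
    have e' : signedEntry 0 b c 0 = -(2 * (b 0 : ℤ) + 1) := by simp [signedEntry]
    rw [e, tStarTrunc_replicate_two_append hN ha (l := [])
      (f := fun k => 2 * N * ((-1) ^ k / node N a k * pochRatio N a k))
      (fun n => (starTransform_base hN ha n).symm)]
    congr 1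
    funext k
    have e2 := signedFactor_div_node_pow (N := N) (a := a) (s := -1) (r := signedEntry 0 b c 0)
      (m := 2 * b 0) (by rw [e', Int.sign_eq_neg_one_of_neg (by omega)]; rfl)
      (by rw [e']; omega) k
    have e3 : interpSum N a (signedTail 0 b c) k = pochRatio N a k := rfl
    have e4 : twoExponent 0 c = 1 := by simp [twoExponent]
    rw [interpTerm, ← e2, e3, e4, signedFactor]
    simp
    ring
  | succ d ih =>
    have hc' : ∀ i, 1 ≤ i → i ≤ d → 1 ≤ c (i + 1) ∧ c (i + 1) ≠ 2 :=
      fun i h1 h2 => hc (i + 1) (by omega) (by omega)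
    have h := fun n => ih (fun i => b (i + 1)) (fun i => c (i + 1)) hc' n
    simp only [starTransform_const_mul] at h
    rw [starIndex_succ]
    rcases eq_one_or_three_le (hc 1 le_rfl (by omega)) with h1 | h1
    · rw [h1, tStarTrunc_replicate_two_append hN ha (tStarTrunc_cons_one hN ha h),
        signedTail_succ, signedEntry_succ_one_of_eq_one h1, h1]
      congr 1
      funext k
      have e := signedEntry_succ_zero_of_eq_one (d := d) (b := b) h1
      rw [interpTerm, interpTerm, ← signedFactor_div_node_pow (s := 1)
        (r := signedEntry (d + 1) b c 0) (m := 2 * b 0)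
        (by rw [e, Int.sign_eq_one_of_pos (by omega)]; rfl) (by rw [e]; omega), twoExponent_succ,
        h1, deltaOne_one, zpow_add₀ two_ne_zero]
      norm_num
      ring
    · rw [tStarTrunc_replicate_two_append hN ha (tStarTrunc_cons_of_three_le hN ha
          (signedEntry_zero_ne_zero hc') h h1),
        signedTail_succ, signedEntry_succ_one_of_three_le h1 hc]
      congr 1
      funext k
      have e := signedEntry_succ_zero_of_three_le (d := d) (b := b) h1
      have e2 : (c 1 : ℤ) - 2 + 2 * ((0 : ℕ) : ℤ) = ((c 1 - 2 : ℕ) : ℤ) := by omega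
      rw [interpTerm, interpTerm, ← signedFactor_div_node_pow (s := -2)
        (r := signedEntry (d + 1) b c 0) (m := 2 * b 0)
        (by rw [e, Int.sign_eq_neg_one_of_neg (by omega)]; rfl) (by rw [e]; omega),
        twoExponent_succ, deltaOne_of_three_le h1, e2, zpow_add₀ two_ne_zero, zpow_natCast]
      ring

/-! ### Mergings of an index -/

theorem tTildeTrunc_singleton (N a : ℕ) (s : ℤ) (n : ℕ) :
    tTildeTrunc N a [s] n =
      ∑ k ∈ Finset.range n, signedFactor N a s k * pochRatio N a k := rfl

theorem tTildeTrunc_cons (N a : ℕ) (s : ℤ) {l : List ℤ} (hl : l ≠ []) (n : ℕ) :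
    tTildeTrunc N a (s :: l) n =
      ∑ k ∈ Finset.range n, signedFactor N a s k * tTildeTrunc N a l k := by
  cases l with
  | nil => exact absurd rfl hl
  | cons t l => rfl

theorem signedAdd_sign {s t : ℤ} (hs : s ≠ 0) (ht : t ≠ 0) :
    (signedAdd s t).sign = s.sign * t.sign := by
  have h1 := abs_pos.2 hs
  have h2 := abs_pos.2 ht
  rw [← Int.sign_mul, signedAdd]
  split_ifs with h
  · rw [Int.sign_eq_one_of_pos h, Int.sign_eq_one_of_pos (by omega)]
  · rw [Int.sign_eq_neg_one_of_neg (lt_of_le_of_ne (not_lt.1 h) (mul_ne_zero hs ht)),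
      Int.sign_eq_neg_one_of_neg (by omega)]

theorem signedAdd_natAbs (s t : ℤ) : (signedAdd s t).natAbs = s.natAbs + t.natAbs := by
  rw [signedAdd, ← Int.natCast_natAbs, ← Int.natCast_natAbs]
  split_ifs <;> omega

theorem signedFactor_signedAdd (N a : ℕ) {s t : ℤ} (hs : s ≠ 0) (ht : t ≠ 0) (k : ℕ) :
    signedFactor N a (signedAdd s t) k = signedFactor N a s k * signedFactor N a t k := by
  rw [signedFactor, signedFactor, signedFactor, signedAdd_sign hs ht, signedAdd_natAbs]
  push_cast
  rw [mul_pow, pow_add, div_mul_div_comm]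

theorem signedAdd_ne_zero {s : ℤ} (hs : s ≠ 0) (t : ℤ) : signedAdd s t ≠ 0 := by
  have := signedAdd_natAbs s t
  omega

theorem ne_nil_of_mem_mergingsAux {s : ℤ} {l : List ℤ} {p : ℕ × List ℤ}
    (hp : p ∈ mergingsAux s l) : p.2 ≠ [] := by
  induction l generalizing s p with
  | nil =>
    rw [mergingsAux, List.mem_singleton] at hp
    simp [hp]
  | cons t l ih =>
    rw [mergingsAux, List.mem_append, List.mem_map, List.mem_map] at hp
    rcases hp with ⟨q, _, rfl⟩ | ⟨q, hq, rfl⟩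
    · simp
    · exact ih (p := q) hq

/-- Prepending a common entry to all members of a list of weighted indices. -/
theorem sum_map_tTildeTrunc_cons (N a : ℕ) (r : ℝ) (s : ℤ) (L : List (ℕ × List ℤ))
    (hL : ∀ p ∈ L, p.2 ≠ []) (n : ℕ) :
    (L.map fun p => r ^ p.1 * tTildeTrunc N a (s :: p.2) n).sum = ∑ k ∈ Finset.range n,
      signedFactor N a s k * (L.map fun p => r ^ p.1 * tTildeTrunc N a p.2 k).sum := by
  induction L with
  | nil => simp
  | cons p L ih =>
    simp only [List.map_cons, List.sum_cons]
    rw [ih fun q hq => hL q (List.mem_cons_of_mem _ hq),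
      tTildeTrunc_cons N a s (hL p List.mem_cons_self), Finset.mul_sum, ← Finset.sum_add_distrib]
    exact Finset.sum_congr rfl fun k _ => by ring

/-- The interpolation at `1/2` of the truncated sums is the sum in which coinciding variables are
weighted by one half. -/
theorem sum_mergingsAux_tTildeTrunc (N a : ℕ) {s : ℤ} {l : List ℤ} (hs : s ≠ 0)
    (hl : ∀ t ∈ l, t ≠ 0) (n : ℕ) :
    ((mergingsAux s l).map fun p => (1 / 2 : ℝ) ^ p.1 * tTildeTrunc N a p.2 n).sum =
      ∑ k ∈ Finset.range n, interpTerm N a s l k := by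
  induction l generalizing s n with
  | nil => simp [mergingsAux, tTildeTrunc_singleton, interpTerm, interpSum]
  | cons t l ih =>
    have ht := hl t List.mem_cons_self
    have hl' := fun u hu => hl u (List.mem_cons_of_mem t hu)
    have e := ih (signedAdd_ne_zero hs t) hl' n
    rw [mergingsAux, List.map_append, List.sum_append, List.map_map, List.map_map]
    have e1 : ((mergingsAux t l).map ((fun p : ℕ × List ℤ => (1 / 2 : ℝ) ^ p.1 *
        tTildeTrunc N a p.2 n) ∘ fun p => (p.1, s :: p.2))).sum = ∑ k ∈ Finset.range n,
          signedFactor N a s k * ∑ j ∈ Finset.range k, interpTerm N a t l j := by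
      simp only [← ih ht hl']
      exact sum_map_tTildeTrunc_cons N a _ s _ (fun p hp => ne_nil_of_mem_mergingsAux hp) n
    have e2 : ((mergingsAux (signedAdd s t) l).map ((fun p : ℕ × List ℤ => (1 / 2 : ℝ) ^ p.1 *
        tTildeTrunc N a p.2 n) ∘ fun p => (p.1 + 1, p.2))).sum =
          1 / 2 * ∑ k ∈ Finset.range n, interpTerm N a (signedAdd s t) l k := by
      rw [← e, ← List.sum_map_mul_left]
      congr 1
      refine List.map_congr_left fun p _ => ?_
      simp only [Function.comp, pow_succ]
      ring
    rw [e1, e2, Finset.mul_sum, ← Finset.sum_add_distrib]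
    refine Finset.sum_congr rfl fun k _ => ?_
    rw [interpTerm, interpTerm, signedFactor_signedAdd N a hs ht, interpSum_cons, halfSum,
      interpTerm]
    ring

/-! ### Convergence of the alternating values -/

theorem pochRatio_nonneg {N a : ℕ} (k : ℕ) : 0 ≤ pochRatio N a k := by
  induction k with
  | zero => rw [pochRatio_zero]; exact zero_le_one
  | succ k ih => rw [pochRatio_succ]; positivity

theorem two_mul_div_le_two {N a : ℕ} (hN : 0 < N) (haN : a ≤ N) : 2 * (a : ℝ) / N ≤ 2 := by
  have hN' : (0 : ℝ) < N := by exact_mod_cast hN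
  have haN' : (a : ℝ) ≤ N := by exact_mod_cast haN
  rw [div_le_iff₀ hN']; linarith

theorem pochRatio_le {N a : ℕ} (hN : 0 < N) (haN : a ≤ N) (k : ℕ) :
    pochRatio N a k ≤ k + 1 := by
  induction k with
  | zero => rw [pochRatio_zero]; simp
  | succ k ih =>
    have h := two_mul_div_le_two hN haN
    rw [pochRatio_succ]
    calc _ ≤ ((k : ℝ) + 1) * ((2 + k) / (k + 1)) := by gcongr
      _ = _ := by push_cast; field_simp; ring

theorem add_one_le_node {N a : ℕ} (hN : 0 < N) (ha : 0 < a) (k : ℕ) :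
    (k : ℝ) + 1 ≤ node N a k := by
  have hN' : (1 : ℝ) ≤ N := by exact_mod_cast hN
  have ha' : (1 : ℝ) ≤ a := by exact_mod_cast ha
  have : (k : ℝ) ≤ N * k := le_mul_of_one_le_left (Nat.cast_nonneg k) hN'
  unfold node; linarith

theorem abs_signedFactor_le {N a : ℕ} (hN : 0 < N) (ha : 0 < a) {s : ℤ} {m : ℕ}
    (hm : m ≤ s.natAbs) (k : ℕ) : |signedFactor N a s k| ≤ 1 / ((k : ℝ) + 1) ^ m := by
  have h1 := add_one_le_node hN ha k
  have h2 : (1 : ℝ) ≤ node N a k := by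
    have : (0 : ℝ) ≤ k := Nat.cast_nonneg k
    linarith
  have h3 : |(s.sign : ℝ)| ≤ 1 := by
    rcases lt_trichotomy s 0 with h | h | h
    · rw [Int.sign_eq_neg_one_of_neg h]; simp
    · rw [h]; simp
    · rw [Int.sign_eq_one_of_pos h]; simp
  rw [signedFactor, abs_div, abs_pow, abs_of_pos (by positivity : 0 < node N a k ^ s.natAbs)]
  calc _ ≤ 1 / node N a k ^ s.natAbs := by
        gcongr; exact pow_le_one₀ (abs_nonneg _) h3
    _ ≤ 1 / node N a k ^ m := by gcongr
    _ ≤ _ := by gcongr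

theorem pochRatio_div_node_antitone {N a : ℕ} (hN : 0 < N) (ha : 0 < a) (haN : a ≤ N) :
    Antitone fun k => pochRatio N a k / node N a k := by
  refine antitone_nat_of_succ_le fun k => ?_
  have hN' : (0 : ℝ) < N := by exact_mod_cast hN
  have ha' : (0 : ℝ) < a := by exact_mod_cast ha
  have haN' : (a : ℝ) ≤ N := by exact_mod_cast haN
  have hk : (0 : ℝ) ≤ k := Nat.cast_nonneg k
  have p1 := node_pos N ha k
  have p2 := node_pos N ha (k + 1)
  rw [pochRatio_succ, mul_div_assoc, div_eq_mul_inv (pochRatio N a k)]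
  refine mul_le_mul_of_nonneg_left ?_ (pochRatio_nonneg k)
  rw [div_div, ← one_div, div_le_div_iff₀ (by positivity) p1, one_mul]
  have e : (2 * (a : ℝ) / N + k) * node N a k = (2 * a + N * k) * (N * k + a) / N := by
    simp only [node]; field_simp
  rw [e, div_le_iff₀ hN']
  simp only [node]
  push_cast
  nlinarith [mul_nonneg (mul_nonneg hN'.le hk) (sub_nonneg.2 haN'),
    mul_nonneg ha'.le (sub_nonneg.2 haN'), mul_nonneg hN'.le (sub_nonneg.2 haN')]

/-- Partial sums of an alternating series with antitone nonnegative terms are bounded by the first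
term. -/
theorem abs_alternating_sum_le {v : ℕ → ℝ} (hv : Antitone v) (h0 : ∀ k, 0 ≤ v k) (n : ℕ) :
    |∑ k ∈ Finset.range n, (-1) ^ k * v k| ≤ v 0 := by
  -- The partial sums corrected by half of the next term have increments `± (v n - v (n + 1)) / 2`.
  have key : |∑ k ∈ Finset.range n, (-1) ^ k * v k + (-1) ^ n * v n / 2| ≤ v 0 - v n / 2 := by
    induction n with
    | zero =>
      simp only [Finset.range_zero, Finset.sum_empty, pow_zero]
      rw [abs_le]
      constructor <;> linarith [h0 0]
    | succ n ih =>
      have hn := hv (Nat.le_succ n)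
      rw [Finset.sum_range_succ, pow_succ]
      rw [abs_le] at ih ⊢
      rcases neg_one_pow_eq_or ℝ n with e | e <;> rw [e] at ih ⊢ <;>
        constructor <;> linarith [ih.1, ih.2]
  have hn := h0 n
  rw [abs_le] at key ⊢
  rcases neg_one_pow_eq_or ℝ n with e | e <;> rw [e] at key <;>
    constructor <;> linarith [key.1, key.2]

theorem signedFactor_neg_one_mul (N a k : ℕ) :
    signedFactor N a (-1) k * pochRatio N a k = (-1) ^ k * (pochRatio N a k / node N a k) := by
  simp [signedFactor]; ring

theorem sum_inv_sqrt_le (n : ℕ) :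
    ∑ k ∈ Finset.range n, 1 / √((k : ℝ) + 1) ≤ 2 * √(n : ℝ) := by
  induction n with
  | zero => simp
  | succ n ih =>
    rw [Finset.sum_range_succ]
    have h1 : 0 < √((n : ℝ) + 1) := Real.sqrt_pos.2 (by positivity)
    have h2 : √((n : ℝ) + 1) ^ 2 = n + 1 := Real.sq_sqrt (by positivity)
    have h3 : √(n : ℝ) ^ 2 = n := Real.sq_sqrt (by positivity)
    have h4 : 1 / √((n : ℝ) + 1) ≤ 2 * √((n : ℝ) + 1) - 2 * √(n : ℝ) := by
      rw [div_le_iff₀ h1]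
      nlinarith [sq_nonneg (√((n : ℝ) + 1) - √(n : ℝ))]
    push_cast
    linarith

/-- The conditions under which the sum with index `s :: l` grows slowly: all entries are nonzero,
and the last one is `-1` or has absolute value at least `2`. -/
def SlowIndex : ℤ → List ℤ → Prop
  | s, [] => s = -1 ∨ 2 ≤ s.natAbs
  | s, t :: l => s ≠ 0 ∧ SlowIndex t l

theorem SlowIndex.ne_zero {s : ℤ} {l : List ℤ} (h : SlowIndex s l) : s ≠ 0 := by
  cases l with
  | nil => rcases h with h | h <;> omega
  | cons t l => exact h.1

theorem SlowIndex.forall_mem_ne_zero {s : ℤ} {l : List ℤ} (h : SlowIndex s l) :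
    ∀ t ∈ l, t ≠ 0 := by
  induction l generalizing s with
  | nil => simp
  | cons t l ih =>
    intro u hu
    rcases List.mem_cons.1 hu with rfl | hu
    · exact h.2.ne_zero
    · exact ih h.2 u hu

theorem SlowIndex.abs_tTildeTrunc_le {N a : ℕ} (hN : 0 < N) (ha : 0 < a) (haN : a ≤ N) {s : ℤ}
    {l : List ℤ} (h : SlowIndex s l) :
    ∃ C : ℝ, 0 ≤ C ∧ ∀ n : ℕ, |tTildeTrunc N a (s :: l) n| ≤ C * √(n : ℝ) := by
  induction l generalizing s with
  | nil =>
    simp only [tTildeTrunc_singleton]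
    by_cases hs : s = -1
    · subst hs
      have h0 : ∀ k, 0 ≤ pochRatio N a k / node N a k :=
        fun k => div_nonneg (pochRatio_nonneg k) (node_pos N ha k).le
      refine ⟨_, h0 0, fun n => ?_⟩
      rcases Nat.eq_zero_or_pos n with rfl | hn
      · simp
      · simp only [signedFactor_neg_one_mul]
        refine (abs_alternating_sum_le (pochRatio_div_node_antitone hN ha haN) h0 n).trans ?_
        refine le_mul_of_one_le_right (h0 0) (Real.one_le_sqrt.2 ?_)
        exact_mod_cast hn
    · have hs2 : 2 ≤ s.natAbs := h.resolve_left hs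
      refine ⟨2, by norm_num, fun n => ?_⟩
      refine (Finset.abs_sum_le_sum_abs _ _).trans (le_trans ?_ (sum_inv_sqrt_le n))
      refine Finset.sum_le_sum fun k _ => ?_
      rw [abs_mul, abs_of_nonneg (pochRatio_nonneg k)]
      have hk : (0 : ℝ) ≤ k := Nat.cast_nonneg k
      calc _ ≤ 1 / ((k : ℝ) + 1) ^ 2 * (k + 1) :=
            mul_le_mul (abs_signedFactor_le hN ha hs2 k) (pochRatio_le hN haN k)
              (pochRatio_nonneg k) (by positivity)
        _ = 1 / ((k : ℝ) + 1) := by field_simp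
        _ ≤ 1 / √((k : ℝ) + 1) := by
            refine one_div_le_one_div_of_le (Real.sqrt_pos.2 (by positivity)) ?_
            rw [Real.sqrt_le_left (by positivity)]
            nlinarith
  | cons t l ih =>
    obtain ⟨C, hC, hb⟩ := ih h.2
    refine ⟨2 * C, by positivity, fun n => ?_⟩
    rw [tTildeTrunc_cons N a s (List.cons_ne_nil t l)]
    have hs1 : 1 ≤ s.natAbs := by have := h.1; omega
    calc _ ≤ ∑ k ∈ Finset.range n, C * (1 / √((k : ℝ) + 1)) := by
          refine (Finset.abs_sum_le_sum_abs _ _).trans (Finset.sum_le_sum fun k _ => ?_)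
          have hk : (0 : ℝ) ≤ k := Nat.cast_nonneg k
          have hq : 0 < √((k : ℝ) + 1) := Real.sqrt_pos.2 (by positivity)
          rw [abs_mul]
          calc _ ≤ 1 / ((k : ℝ) + 1) ^ 1 * (C * √((k : ℝ) + 1)) :=
                mul_le_mul (abs_signedFactor_le hN ha hs1 k) ((hb k).trans (by gcongr; linarith))
                  (abs_nonneg _) (by positivity)
            _ = _ := by
                have h2 : √((k : ℝ) + 1) ^ 2 = k + 1 := Real.sq_sqrt (by positivity)
                rw [pow_one]
                field_simp
                rw [h2, mul_comm]
      _ ≤ _ := by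
          rw [← Finset.mul_sum]
          nlinarith [sum_inv_sqrt_le n]

/-- Sufficient conditions for the absolute convergence of the series with index `s :: l`. -/
def SummableIndex (s : ℤ) (l : List ℤ) : Prop :=
  SlowIndex s l ∧ 2 ≤ s.natAbs ∧ (l = [] → 3 ≤ s.natAbs)

theorem tendsto_sum_range_of_abs_le {f g : ℕ → ℝ} (hg : Summable g) (h : ∀ k, |f k| ≤ g k) :
    ∃ L, Filter.Tendsto (fun n => ∑ k ∈ Finset.range n, f k) Filter.atTop (nhds L) :=
  ⟨_, (Summable.of_norm_bounded hg h).hasSum.tendsto_sum_nat⟩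

theorem SummableIndex.exists_tendsto {N a : ℕ} (hN : 0 < N) (ha : 0 < a) (haN : a ≤ N) {s : ℤ}
    {l : List ℤ} (h : SummableIndex s l) :
    ∃ L, Filter.Tendsto (fun n => tTildeTrunc N a (s :: l) n) Filter.atTop (nhds L) := by
  obtain ⟨h1, h2, h3⟩ := h
  cases l with
  | nil =>
    have hs : Summable fun k : ℕ => 1 / ((k : ℝ) + 1) ^ 2 := by
      have := (summable_nat_add_iff 1).2 (Real.summable_one_div_nat_pow.2 one_lt_two)
      simpa using this
    refine tendsto_sum_range_of_abs_le hs fun k => ?_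
    change |signedFactor N a s k * pochRatio N a k| ≤ _
    rw [abs_mul, abs_of_nonneg (pochRatio_nonneg k)]
    have hk : (0 : ℝ) ≤ k := Nat.cast_nonneg k
    calc _ ≤ 1 / ((k : ℝ) + 1) ^ 3 * (k + 1) :=
          mul_le_mul (abs_signedFactor_le hN ha (h3 rfl) k) (pochRatio_le hN haN k)
            (pochRatio_nonneg k) (by positivity)
      _ = _ := by field_simp
  | cons t l =>
    obtain ⟨C, hC, hb⟩ := h1.2.abs_tTildeTrunc_le hN ha haN
    simp only [tTildeTrunc_cons N a s (List.cons_ne_nil t l)]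
    have hs : Summable fun k : ℕ => C * ((k : ℝ) + 1) ^ (-(3 / 2) : ℝ) := by
      have h := Real.summable_nat_rpow (p := -(3 / 2)) |>.2 (by norm_num)
      have := (summable_nat_add_iff 1).2 h
      refine Summable.mul_left C ?_
      simpa using this
    refine tendsto_sum_range_of_abs_le hs fun k => ?_
    have hk : (0 : ℝ) ≤ k := Nat.cast_nonneg k
    have hk1 : (0 : ℝ) < k + 1 := by positivity
    rw [abs_mul]
    calc _ ≤ 1 / ((k : ℝ) + 1) ^ 2 * (C * √((k : ℝ) + 1)) :=
          mul_le_mul (abs_signedFactor_le hN ha h2 k) ((hb k).trans (by gcongr; linarith))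
            (abs_nonneg _) (by positivity)
      _ = C * (((k : ℝ) + 1) ^ (-2 : ℝ) * ((k : ℝ) + 1) ^ (1 / 2 : ℝ)) := by
          rw [Real.sqrt_eq_rpow, Real.rpow_neg hk1.le, Real.rpow_two]; ring
      _ = _ := by rw [← Real.rpow_add hk1]; norm_num

theorem SlowIndex.signedAdd {s t : ℤ} {l : List ℤ} (h : SlowIndex s (t :: l)) :
    SlowIndex (signedAdd s t) l := by
  have e := signedAdd_natAbs s t
  have h1 := h.1
  have h2 := h.2.ne_zero
  cases l with
  | nil => exact Or.inr (by omega)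
  | cons u l => exact ⟨signedAdd_ne_zero h1 t, h.2.2⟩

theorem SlowIndex.of_mem_mergingsAux {s : ℤ} {l : List ℤ} (h : SlowIndex s l)
    {p : ℕ × List ℤ} (hp : p ∈ mergingsAux s l) : ∃ u m, p.2 = u :: m ∧ SlowIndex u m := by
  induction l generalizing s p with
  | nil =>
    rw [mergingsAux, List.mem_singleton] at hp
    exact ⟨s, [], by rw [hp], h⟩
  | cons t l ih =>
    rw [mergingsAux, List.mem_append, List.mem_map, List.mem_map] at hp
    rcases hp with ⟨q, hq, rfl⟩ | ⟨q, hq, rfl⟩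
    · obtain ⟨u, m, e, hu⟩ := ih h.2 hq
      exact ⟨s, u :: m, by rw [e], h.1, hu⟩
    · exact ih (p := q) h.signedAdd hq

theorem SummableIndex.of_mem_mergingsAux {s : ℤ} {l : List ℤ} (h : SummableIndex s l)
    {p : ℕ × List ℤ} (hp : p ∈ mergingsAux s l) : ∃ u m, p.2 = u :: m ∧ SummableIndex u m := by
  induction l generalizing s p with
  | nil =>
    rw [mergingsAux, List.mem_singleton] at hp
    exact ⟨s, [], by rw [hp], h⟩
  | cons t l ih =>
    rw [mergingsAux, List.mem_append, List.mem_map, List.mem_map] at hp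
    rcases hp with ⟨q, hq, rfl⟩ | ⟨q, hq, rfl⟩
    · obtain ⟨u, m, e, hu⟩ := h.1.2.of_mem_mergingsAux hq
      exact ⟨s, u :: m, by rw [e], ⟨h.1.1, hu⟩, h.2.1, by simp⟩
    · have e := signedAdd_natAbs s t
      have h2 := h.1.2.ne_zero
      have h3 := h.2.1
      exact ih (p := q) ⟨h.1.signedAdd, by omega, fun _ => by omega⟩ hq

theorem slowIndex_replicate_one_append {s : ℤ} {l : List ℤ} (h : SlowIndex s l) (m : ℕ) {r : ℤ}
    (hr : r ≠ 0) : SlowIndex r (List.replicate m 1 ++ s :: l) := by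
  induction m generalizing r with
  | zero => exact ⟨hr, h⟩
  | succ m ih => exact ⟨hr, ih one_ne_zero⟩

theorem flipSucc_natAbs {s : ℤ} (hs : s ≠ 0) : (flipSucc s).natAbs = s.natAbs + 1 := by
  rw [flipSucc]
  rcases lt_or_gt_of_ne hs with h | h
  · rw [Int.sign_eq_neg_one_of_neg h]; omega
  · rw [Int.sign_eq_one_of_pos h]; omega

theorem SlowIndex.flipSucc {s : ℤ} {l : List ℤ} (h : SlowIndex s l) :
    SlowIndex (flipSucc s) l := by
  have e := flipSucc_natAbs h.ne_zero
  have h0 := h.ne_zero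
  cases l with
  | nil => exact Or.inr (by omega)
  | cons t l => exact ⟨by omega, h.2⟩

theorem slowIndex_signedIndex {d : ℕ} {b c : ℕ → ℕ}
    (hc : ∀ i, 1 ≤ i → i ≤ d → 1 ≤ c i ∧ c i ≠ 2) :
    SlowIndex (signedEntry d b c 0) (signedTail d b c) := by
  induction d generalizing b c with
  | zero =>
    have e : signedEntry 0 b c 0 = -(2 * (b 0 : ℤ) + 1) := by simp [signedEntry]
    have : signedEntry 0 b c 0 = -1 ∨ 2 ≤ (signedEntry 0 b c 0).natAbs := by rw [e]; omega
    exact this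
  | succ d ih =>
    have h := ih (b := fun i => b (i + 1)) (c := fun i => c (i + 1))
      fun i h1 h2 => hc (i + 1) (by omega) (by omega)
    rw [signedTail_succ]
    refine slowIndex_replicate_one_append ?_ _ (signedEntry_zero_ne_zero hc)
    rcases eq_one_or_three_le (hc 1 le_rfl (by omega)) with h1 | h1
    · rw [signedEntry_succ_one_of_eq_one h1]; exact h
    · rw [signedEntry_succ_one_of_three_le h1 hc]; exact h.flipSucc

theorem summableIndex_signedIndex {d : ℕ} {b c : ℕ → ℕ}
    (hc : ∀ i, 1 ≤ i → i ≤ d → 1 ≤ c i ∧ c i ≠ 2) (hconv : 1 ≤ d → b 0 = 0 → 3 ≤ c 1)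
    (h : d ≠ 0 ∨ b 0 ≠ 0) : SummableIndex (signedEntry d b c 0) (signedTail d b c) := by
  refine ⟨slowIndex_signedIndex hc, ?_⟩
  cases d with
  | zero =>
    have e : signedEntry 0 b c 0 = -(2 * (b 0 : ℤ) + 1) := by simp [signedEntry]
    have h0 : b 0 ≠ 0 := by simpa using h
    rw [e]
    exact ⟨by omega, fun _ => by omega⟩
  | succ d =>
    refine ⟨?_, fun h' => by simp [signedTail_succ] at h'⟩
    rcases eq_one_or_three_le (hc 1 le_rfl (by omega)) with h1 | h1
    · have h0 : b 0 ≠ 0 := fun h0 => by have := hconv (by omega) h0; omega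
      rw [signedEntry_succ_zero_of_eq_one h1]; omega
    · rw [signedEntry_succ_zero_of_three_le h1]; omega

theorem prod_range_succ_eq_pochRatio (N a k : ℕ) :
    ∏ j ∈ Finset.range k, (2 * (a : ℝ) / N + j) = pochRatio N a k * k.factorial := by
  induction k with
  | zero => simp [pochRatio_zero]
  | succ k ih =>
    rw [Finset.prod_range_succ, ih, pochRatio_succ, Nat.factorial_succ]
    push_cast
    field_simp

theorem tendsto_pochRatio_div_node {N a : ℕ} (ha : 0 < a) (haN : a < N) :
    Filter.Tendsto (fun k => pochRatio N a k / node N a k) Filter.atTop (nhds 0) := by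
  have hN' : (0 : ℝ) < N := by exact_mod_cast ha.trans haN
  have ha' : (0 : ℝ) < a := by exact_mod_cast ha
  have haN' : (a : ℝ) < N := by exact_mod_cast haN
  set y : ℝ := 2 * (a : ℝ) / N with hy
  have hy0 : 0 < y := by positivity
  have hy2 : y < 2 := by rw [hy, div_lt_iff₀ hN']; linarith
  have h1 := (Real.GammaSeq_tendsto_Gamma y).inv₀ (Real.Gamma_pos_of_pos hy0).ne'
  have h2 : Filter.Tendsto (fun k : ℕ => (k : ℝ) ^ (-(2 - y))) Filter.atTop (nhds 0) :=
    (tendsto_rpow_neg_atTop (by linarith)).comp tendsto_natCast_atTop_atTop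
  have h3 := (h1.mul h2).const_mul ((1 : ℝ) / N)
  rw [mul_zero, mul_zero] at h3
  refine squeeze_zero' (Filter.Eventually.of_forall fun k =>
    div_nonneg (pochRatio_nonneg k) (node_pos N ha k).le) ?_ h3
  filter_upwards [Filter.eventually_gt_atTop 0] with k hk
  have hk' : (0 : ℝ) < k := by exact_mod_cast hk
  have hr : 0 ≤ pochRatio N a k := pochRatio_nonneg k
  have e : (Real.GammaSeq y k)⁻¹ * (k : ℝ) ^ (-(2 - y)) = pochRatio N a k * (y + k) / k ^ 2 := by
    have hp := Real.rpow_pos_of_pos hk' y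
    have hf : (0 : ℝ) < k.factorial := by positivity
    rw [Real.GammaSeq, Finset.prod_range_succ, prod_range_succ_eq_pochRatio, neg_sub,
      Real.rpow_sub hk', Real.rpow_two]
    field_simp
  rw [e]
  have hp := node_pos N ha k
  calc pochRatio N a k / node N a k ≤ pochRatio N a k / (N * k) := by
        gcongr
        simp only [node]; linarith
    _ = 1 / N * (pochRatio N a k * k / k ^ 2) := by field_simp
    _ ≤ _ := by gcongr; linarith

/-- All values that occur in the interpolated value converge. -/
theorem exists_tendsto_of_mem_mergings {N a : ℕ} (ha : 0 < a) (haN : a ≤ N) {d : ℕ} {b c : ℕ → ℕ}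
    (hc : ∀ i, 1 ≤ i → i ≤ d → 1 ≤ c i ∧ c i ≠ 2) (hconv : 1 ≤ d → b 0 = 0 → 3 ≤ c 1)
    (hedge : d = 0 → b 0 = 0 → a ≠ N) {p : ℕ × List ℤ} (hp : p ∈ mergings (signedIndex d b c)) :
    ∃ L, Filter.Tendsto (fun n => tTildeTrunc N a p.2 n) Filter.atTop (nhds L) := by
  have hN := ha.trans_le haN
  by_cases h : d ≠ 0 ∨ b 0 ≠ 0
  · obtain ⟨u, m, e, hu⟩ := (summableIndex_signedIndex hc hconv h).of_mem_mergingsAux hp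
    rw [e]
    exact hu.exists_tendsto hN ha haN
  · push Not at h
    obtain ⟨rfl, h0⟩ := h
    have e : signedIndex 0 b c = [-1] := by simp [signedIndex, signedEntry, h0]
    rw [e, mergings, mergingsAux, List.mem_singleton] at hp
    rw [hp]
    simp only [tTildeTrunc_singleton, signedFactor_neg_one_mul]
    exact (pochRatio_div_node_antitone hN ha haN).tendsto_alternating_series_of_tendsto_zero
      (tendsto_pochRatio_div_node ha (lt_of_le_of_ne haN (hedge rfl h0)))

/-! ### The limit of the finite identity -/

theorem starKernel_nonneg {N a : ℕ} (n k : ℕ) : 0 ≤ starKernel N a n k := by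
  rcases lt_or_ge n k with h | h
  · rw [starKernel_eq_zero h]
  · refine mul_nonneg (by positivity) (Finset.prod_nonneg fun j hj => ?_)
    have hj' : (j : ℝ) ≤ n := by exact_mod_cast (Finset.mem_range.1 hj).le.trans h
    exact div_nonneg (sub_nonneg.2 hj') (by positivity)

theorem starKernel_antitone {N a : ℕ} (hN : 0 < N) (ha : 0 < a) (n : ℕ) :
    Antitone (starKernel N a n) := by
  refine antitone_nat_of_succ_le fun k => ?_
  have p1 := node_pos N ha n
  have p2 := node_pos N ha (k + 1)
  have p3 := node_pos N ha k
  have h := starKernel_succ_right hN ha n k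
  have h0 := starKernel_nonneg (N := N) (a := a) n k
  refine le_of_mul_le_mul_right ?_ (add_pos p1 p2)
  rw [h]
  exact mul_le_mul_of_nonneg_left (by linarith) h0

theorem tendsto_starKernel_zero {N a : ℕ} (hN : 0 < N) (ha : 0 < a) :
    Filter.Tendsto (fun n => starKernel N a n 0) Filter.atTop
      (nhds (ProbabilityTheory.beta ((a : ℝ) / N) ((a : ℝ) / N))⁻¹) := by
  have hN' : (0 : ℝ) < N := by exact_mod_cast hN
  have ha' : (0 : ℝ) < a := by exact_mod_cast ha
  set x : ℝ := (a : ℝ) / N with hx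
  have hx0 : 0 < x := by positivity
  have e2 : 2 * (a : ℝ) / N = x + x := by rw [hx]; ring
  have hG := Real.Gamma_pos_of_pos hx0
  have h := (Real.GammaSeq_tendsto_Gamma (x + x)).div
    ((Real.GammaSeq_tendsto_Gamma x).mul (Real.GammaSeq_tendsto_Gamma x)) (by positivity)
  rw [ProbabilityTheory.beta, inv_div]
  refine h.congr' ?_
  filter_upwards [Filter.eventually_gt_atTop 0] with n hn
  have hn' : (0 : ℝ) < n := by exact_mod_cast hn
  have hp := Real.rpow_pos_of_pos hn' x
  have hf : (0 : ℝ) < n.factorial := by positivity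
  have h1 : (0 : ℝ) < ∏ j ∈ Finset.range (n + 1), (x + j) :=
    Finset.prod_pos fun j _ => by positivity
  have h2 : (0 : ℝ) < ∏ j ∈ Finset.range (n + 1), (x + x + j) :=
    Finset.prod_pos fun j _ => by positivity
  simp only [Pi.div_apply, Real.GammaSeq]
  rw [starKernel, ← hx, e2, Real.rpow_add hn', Finset.range_zero, Finset.prod_empty, mul_one]
  field_simp

theorem tendsto_starKernel {N a : ℕ} (hN : 0 < N) (ha : 0 < a) (k : ℕ) :
    Filter.Tendsto (fun n => starKernel N a n k) Filter.atTop
      (nhds (ProbabilityTheory.beta ((a : ℝ) / N) ((a : ℝ) / N))⁻¹) := by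
  have hN' : (0 : ℝ) < N := by exact_mod_cast hN
  induction k with
  | zero => exact tendsto_starKernel_zero hN ha
  | succ k ih =>
    have ht : Filter.Tendsto (fun n => node N a n) Filter.atTop Filter.atTop :=
      Filter.tendsto_atTop_add_const_right _ _
        (tendsto_natCast_atTop_atTop.const_mul_atTop hN')
    have ht2 := Filter.tendsto_atTop_add_const_right _ (node N a (k + 1)) ht
    have h1 := ht2.inv_tendsto_atTop.const_mul (node N a k + node N a (k + 1))
    have h2 := ih.mul (h1.const_sub 1)
    rw [mul_zero, sub_zero, mul_one] at h2
    refine h2.congr fun n => ?_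
    have p1 := node_pos N ha n
    have p2 := node_pos N ha (k + 1)
    have h := starKernel_succ_right hN ha n k
    have p3 : node N a n + node N a (k + 1) ≠ 0 := by positivity
    simp only [Pi.inv_apply]
    field_simp
    linear_combination -h

/-- A convergent series weighted by an antitone kernel of finite support that converges pointwise
to a constant: the weighted sums converge to that constant times the sum of the series. No absolute
convergence is needed. -/
theorem tendsto_sum_antitone_kernel_mul {w : ℕ → ℕ → ℝ} {f : ℕ → ℝ} {W L : ℝ}
    (h0 : ∀ n k, n < k → w n k = 0) (hw : ∀ n, Antitone (w n))
    (hlim : ∀ k, Filter.Tendsto (fun n => w n k) Filter.atTop (nhds W))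
    (hf : Filter.Tendsto (fun n => ∑ k ∈ Finset.range n, f k) Filter.atTop (nhds L)) :
    Filter.Tendsto (fun n => ∑ k ∈ Finset.range (n + 1), w n k * f k) Filter.atTop
      (nhds (W * L)) := by
  set T : ℕ → ℝ := fun n => ∑ k ∈ Finset.range n, f k - L with hT
  have hTlim : Filter.Tendsto T Filter.atTop (nhds 0) := by
    have := hf.sub_const L
    rwa [sub_self] at this
  have abel : ∀ n K, ∑ k ∈ Finset.range K, w n k * f k =
      w n 0 * L + w n K * T K + ∑ k ∈ Finset.range K, (w n k - w n (k + 1)) * T (k + 1) := by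
    intro n K
    induction K with
    | zero => simp [hT]
    | succ K ih =>
      rw [Finset.sum_range_succ, ih, Finset.sum_range_succ]
      have : T (K + 1) = T K + f K := by simp only [hT, Finset.sum_range_succ]; ring
      rw [this]
      ring
  have hR : Filter.Tendsto (fun n => ∑ k ∈ Finset.range (n + 1),
      (w n k - w n (k + 1)) * T (k + 1)) Filter.atTop (nhds 0) := by
    rw [Metric.tendsto_nhds]
    intro ε hε
    set η := ε / (2 * (|W| + 1)) with hη
    have hη0 : 0 < η := by positivity
    obtain ⟨K, hK⟩ := Filter.eventually_atTop.1 (Metric.tendsto_nhds.1 hTlim η hη0)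
    have hA : Filter.Tendsto (fun n => ∑ k ∈ Finset.range K,
        (w n k - w n (k + 1)) * |T (k + 1)| + η * w n 0) Filter.atTop (nhds (η * W)) := by
      have h1 := tendsto_finsetSum (Finset.range K) fun k _ =>
        ((hlim k).sub (hlim (k + 1))).mul_const |T (k + 1)|
      have h2 := h1.add ((hlim 0).const_mul η)
      simpa using h2
    have hlt : η * W < ε := by
      have : η * (2 * (|W| + 1)) = ε := by rw [hη]; field_simp
      nlinarith [le_abs_self W, abs_nonneg W]
    filter_upwards [hA.eventually_lt_const hlt, Filter.eventually_ge_atTop K] with n hn hnK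
    rw [Real.dist_eq, sub_zero]
    refine lt_of_le_of_lt ?_ hn
    have hd : ∀ k, 0 ≤ w n k - w n (k + 1) := fun k => sub_nonneg.2 (hw n (Nat.le_succ k))
    calc _ ≤ ∑ k ∈ Finset.range (n + 1), (w n k - w n (k + 1)) * |T (k + 1)| := by
          refine (Finset.abs_sum_le_sum_abs _ _).trans (Finset.sum_le_sum fun k _ => ?_)
          rw [abs_mul, abs_of_nonneg (hd k)]
      _ = ∑ k ∈ Finset.range K, (w n k - w n (k + 1)) * |T (k + 1)| +
          ∑ k ∈ Finset.Ico K (n + 1), (w n k - w n (k + 1)) * |T (k + 1)| :=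
          (Finset.sum_range_add_sum_Ico _ (by omega)).symm
      _ ≤ _ := by
          gcongr
          calc _ ≤ ∑ k ∈ Finset.Ico K (n + 1), η * (w n k - w n (k + 1)) := by
                refine Finset.sum_le_sum fun k hk => ?_
                have hk' := (Finset.mem_Ico.1 hk).1
                have h := hK (k + 1) (by omega)
                rw [Real.dist_eq, sub_zero] at h
                rw [mul_comm]
                exact mul_le_mul_of_nonneg_right h.le (hd k)
            _ ≤ ∑ k ∈ Finset.range (n + 1), η * (w n k - w n (k + 1)) := by
                refine Finset.sum_le_sum_of_subset_of_nonneg ?_ fun k _ _ =>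
                  mul_nonneg hη0.le (hd k)
                intro k hk
                exact Finset.mem_range.2 (Finset.mem_Ico.1 hk).2
            _ = _ := by
                rw [← Finset.mul_sum, Finset.sum_range_sub', h0 n (n + 1) (Nat.lt_succ_self n),
                  sub_zero]
  have h := ((hlim 0).mul_const L).add hR
  rw [add_zero] at h
  refine h.congr fun n => ?_
  rw [abel, h0 n (n + 1) (Nat.lt_succ_self n)]
  ring

theorem tendsto_sum_map_mul {α : Type*} {l : List α} {r : α → ℝ} {g : α → ℕ → ℝ} {L : α → ℝ}
    (h : ∀ p ∈ l, Filter.Tendsto (g p) Filter.atTop (nhds (L p))) :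
    Filter.Tendsto (fun n => (l.map fun p => r p * g p n).sum) Filter.atTop
      (nhds (l.map fun p => r p * L p).sum) :=
  tendsto_list_sum l fun p hp => (h p hp).const_mul (r p)

theorem mainTheorem5 (N a : ℕ) (ha : 1 ≤ a) (haN : a ≤ N) (d : ℕ) (b c : ℕ → ℕ)
    (hc : ∀ i, 1 ≤ i → i ≤ d → 1 ≤ c i ∧ c i ≠ 2)
    (hconv : 1 ≤ d → b 0 = 0 → 3 ≤ c 1)
    (hedge : d = 0 → b 0 = 0 → a ≠ N) :
    Filter.Tendsto (fun n : ℕ => tStarTrunc N a (starIndex d b c) n) Filter.atTop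
      (nhds (tStar N a (starIndex d b c))) ∧
    (∀ p ∈ mergings (signedIndex d b c),
      Filter.Tendsto (fun n : ℕ => tTildeTrunc N a p.2 n) Filter.atTop
        (nhds (tTilde N a p.2))) ∧
    tStar N a (starIndex d b c) =
      (N : ℝ) * (2 : ℝ) ^ ((∑ i ∈ Finset.Icc 1 d, (c i : ℤ)) + 1 - 2 * (d : ℤ)
          + 2 * ∑ i ∈ Finset.Icc 1 d, (deltaOne (c i) : ℤ))
        / ProbabilityTheory.beta ((a : ℝ) / N) ((a : ℝ) / N)
        * tTildeInterp N a (1 / 2) (signedIndex d b c) := by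
  have hN : 0 < N := lt_of_lt_of_le ha haN
  have hconvergent : ∀ p ∈ mergings (signedIndex d b c),
      Filter.Tendsto (fun n : ℕ => tTildeTrunc N a p.2 n) Filter.atTop
        (nhds (tTilde N a p.2)) := fun p hp =>
    tendsto_nhds_limUnder (exists_tendsto_of_mem_mergings ha haN hc hconv hedge hp)
  have hslow := slowIndex_signedIndex (b := b) hc
  -- The partial sums of the interpolated summand converge to the interpolated value.
  have hsum : Filter.Tendsto (fun n => ∑ k ∈ Finset.range n,
      interpTerm N a (signedEntry d b c 0) (signedTail d b c) k) Filter.atTop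
      (nhds (tTildeInterp N a (1 / 2) (signedIndex d b c))) :=
    (tendsto_sum_map_mul hconvergent).congr fun n =>
      sum_mergingsAux_tTildeTrunc N a hslow.ne_zero hslow.forall_mem_ne_zero n
  have hstar := (tendsto_sum_antitone_kernel_mul (fun n k h => starKernel_eq_zero h)
    (starKernel_antitone hN ha) (tendsto_starKernel hN ha) hsum).const_mul
      ((N : ℝ) * 2 ^ twoExponent d c)
  have hstar' := hstar.congr fun n => (tStarTrunc_starIndex hN ha d b c hc n).symm
  have hlim : tStar N a (starIndex d b c) = _ := hstar'.limUnder_eq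
  refine ⟨by rw [hlim]; exact hstar', hconvergent, ?_⟩
  rw [hlim, twoExponent]
  ring
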